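/- Consider a discounted Markov decision process with measurable state space $\mathcal S$ and action space $\mathcal A$, transition kernel $P(\cdot\mid s,a)$, initial state distribution $\rho$, discount factor $\gamma\in(0,1)$ and measurable reward $R:\mathcal S\times\mathcal A\to[-R_{\max},R_{\max}]$, $R_{\max}>0$. Let $\{\pi_\theta:\theta\in\mathbb R^d\}$ be a family of stochastic policies, where $\pi_\theta(\cdot\mid s)$ is a probability density with respect to a fixed $\sigma$-finite measure on $\mathcal A$ (for instance counting or Lebesgue measure), jointly measurable in $(s,a)$ and differentiable in $\theta$. Let $p(\cdot\mid\pi_\theta)$ be the law of the trajectory $\tau=(s_t,a_t)_{t\ge 0}$ with $s_0\sim\rho$, $a_t\sim\pi_\theta(\cdot\mid s_t)$, $s_{t+1}\sim P(\cdot\mid s_t,a_t)$, and write $\mathbb E$ for the expectation under $\tau\sim p(\cdot\mid\pi_\theta)$. For $\mathsf H\in\{0,1,2,\dots\}$ put $$J(\theta)=\mathbb E\Big[\sum_{t=0}^{\infty}\gamma^tR(s_t,a_t)\Big],\qquad J_{\mathsf H}(\theta)=\mathbb E\Big[\sum_{t=0}^{\mathsf H-1}\gamma^tR(s_t,a_t)\Big].$$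 Assume that there are constants $G_1,G_2>0$ such that for all $\theta,s,a$: $\pi_\theta(a\mid s)>0$, $\theta\mapsto\log\pi_\theta(a\mid s)$ is twice differentiable, $\|\nabla_\theta\log\pi_\theta(a\mid s)\|\le G_1$ and $\|\nabla_\theta^2\log\pi_\theta(a\mid s)\|\le G_2$ (Euclidean norm for vectors, operator norm for matrices). Then $J$ and $J_{\mathsf H}$ are twice differentiable on $\mathbb R^d$; the gradient and Hessian of $J_{\mathsf H}$ are given by $$\nabla J_{\mathsf H}(\theta)=\mathbb E\Big[\sum_{h=0}^{\mathsf H-1}\Big(\sum_{t=h}^{\mathsf H-1}\gamma^tR(s_t,a_t)\Big)\nabla_\theta\log\pi_\theta(a_h\mid s_h)\Big],$$ $$\nabla^2J_{\mathsf H}(\theta)=\mathbb E\Big[\nabla_\theta\Phi(\theta;\tau)\Big(\sum_{h=0}^{\mathsf H-1}\nabla_\theta\log\pi_\theta(a_h\mid s_h)\Big)^{T}+\nabla_\theta^2\Phi(\theta;\tau)\Big],\qquad \Phi(\theta;\tau)=\sum_{h=0}^{\mathsf H-1}\sum_{t=h}^{\mathsf H-1}\gamma^tR(s_t,a_t)\log\pi_\theta(a_h\mid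 s_h);$$ and for every $\theta\in\mathbb R^d$ $$\|\nabla J(\theta)-\nabla J_{\mathsf H}(\theta)\|\le D_g\gamma^{\mathsf H},\qquad \|\nabla^2J(\theta)-\nabla^2J_{\mathsf H}(\theta)\|\le D_H\gamma^{\mathsf H},$$ where $$D_g=\frac{G_1R_{\max}}{1-\gamma}\sqrt{\frac1{1-\gamma}+\mathsf H},\qquad D_H=\frac{R_{\max}(G_2+G_1^2)}{1-\gamma}\Big(\mathsf H+\frac1{1-\gamma}\Big).$$ -/

import Mathlib

open MeasureTheory ProbabilityTheory Finset

/-- A discounted Markov decision process with state space `S` and action space `A`: transition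
kernel `P`, bounded reward `R`, initial state distribution `ρ` and discount factor `γ`. -/
structure MDP (S A : Type*) [MeasurableSpace S] [MeasurableSpace A] where
  P : Kernel (S × A) S
  isMarkovKernel_P : IsMarkovKernel P
  Rmax : ℝ
  Rmax_pos : 0 < Rmax
  R : S → A → ℝ
  measurable_R : Measurable (Function.uncurry R)
  abs_R_le : ∀ s a, |R s a| ≤ Rmax
  ρ : Measure S
  isProbabilityMeasure_ρ : IsProbabilityMeasure ρ
  γ : ℝ
  γ_pos : 0 < γ
  γ_lt_one : γ < 1

attribute [instance] MDP.isMarkovKernel_P MDP.isProbabilityMeasure_ρ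

/-- A family of stochastic policies parametrized by `θ ∈ ℝ^d` and differentiable in `θ`:
`π.dens θ s a` is the density `π_θ(a|s)` of the action with respect to the reference measure `ν`
(counting measure for a discrete action space, Lebesgue measure for a continuous one). -/
structure PolicyFamily (S : Type*) {A : Type*} [MeasurableSpace S] [MeasurableSpace A]
    (ν : Measure A) (d : ℕ) where
  dens : EuclideanSpace ℝ (Fin d) → S → A → ℝ
  dens_nonneg : ∀ θ s a, 0 ≤ dens θ s a
  measurable_dens : ∀ θ, Measurable (Function.uncurry (dens θ))
  lintegral_dens : ∀ θ s, ∫⁻ a, ENNReal.ofReal (dens θ s a) ∂ν = 1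
  differentiable_dens : ∀ s a, Differentiable ℝ (fun θ => dens θ s a)

/-- The Hessian of `f` as an operator on `ℝ^d`: the derivative of its gradient. The norm on
`ℝ^d →L[ℝ] ℝ^d` is the operator norm. -/
noncomputable def hessian {d : ℕ} (f : EuclideanSpace ℝ (Fin d) → ℝ)
    (θ : EuclideanSpace ℝ (Fin d)) :
    EuclideanSpace ℝ (Fin d) →L[ℝ] EuclideanSpace ℝ (Fin d) :=
  fderiv ℝ (gradient f) θ

namespace PolicyFamily

variable {S A : Type*} [MeasurableSpace S] [MeasurableSpace A] {ν : Measure A} {d : ℕ}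

/-- `log π_θ(a|s)` as a function of `θ`. -/
noncomputable def logDens (π : PolicyFamily S ν d) (s : S) (a : A)
    (θ : EuclideanSpace ℝ (Fin d)) : ℝ :=
  Real.log (π.dens θ s a)

/-- Lipschitz and smooth policies with constants `G₁, G₂ > 0`: the function `log π_θ(a|s)` is
defined (`π_θ(a|s) > 0`), is twice differentiable in `θ`, its gradient is bounded by `G₁` and its
Hessian by `G₂`. -/
structure LS (π : PolicyFamily S ν d) (G₁ G₂ : ℝ) : Prop where
  G₁_pos : 0 < G₁
  G₂_pos : 0 < G₂
  dens_pos : ∀ θ s a, 0 < π.dens θ s a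
  differentiable_gradient : ∀ s a, Differentiable ℝ (gradient (π.logDens s a))
  norm_gradient_le : ∀ θ s a, ‖gradient (π.logDens s a) θ‖ ≤ G₁
  norm_hessian_le : ∀ θ s a, ‖hessian (π.logDens s a) θ‖ ≤ G₂

variable [SigmaFinite ν]

/-- The law of the action given the state, `π_θ(da|s) = π_θ(a|s) ν(da)`. -/
noncomputable def kernel (π : PolicyFamily S ν d) (θ : EuclideanSpace ℝ (Fin d)) : Kernel S A :=
  (Kernel.const S ν).withDensity (fun s a => ENNReal.ofReal (π.dens θ s a))

instance (π : PolicyFamily S ν d) (θ : EuclideanSpace ℝ (Fin d)) :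
    IsMarkovKernel (π.kernel θ) := by
  refine ⟨fun s => ⟨?_⟩⟩
  have hm : Measurable (Function.uncurry fun s a => ENNReal.ofReal (π.dens θ s a)) :=
    ENNReal.measurable_ofReal.comp (π.measurable_dens θ)
  rw [kernel, Kernel.withDensity_apply' _ hm, Kernel.const_apply, setLIntegral_univ]
  exact π.lintegral_dens θ s

end PolicyFamily

namespace MDP

variable {S A : Type*} [MeasurableSpace S] [MeasurableSpace A] {ν : Measure A} [SigmaFinite ν]
  {d : ℕ}

/-- One step of the state-action process: from `(s, a)` draw `s' ~ P(·|s, a)` and then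
`a' ~ π_θ(·|s')`. -/
noncomputable def stepKernel (M : MDP S A) (π : PolicyFamily S ν d)
    (θ : EuclideanSpace ℝ (Fin d)) : Kernel (S × A) (S × A) :=
  M.P ⊗ₖ Kernel.prodMkLeft (S × A) (π.kernel θ)

instance (M : MDP S A) (π : PolicyFamily S ν d) (θ : EuclideanSpace ℝ (Fin d)) :
    IsMarkovKernel (M.stepKernel π θ) := by
  unfold stepKernel; infer_instance

/-- The step kernel applied to the last entry of the history up to time `n`. -/
noncomputable def historyKernel (M : MDP S A) (π : PolicyFamily S ν d)
    (θ : EuclideanSpace ℝ (Fin d)) (n : ℕ) : Kernel ((i : Iic n) → S × A) (S × A) :=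
  (M.stepKernel π θ).comap (fun h => h ⟨n, mem_Iic.2 le_rfl⟩) (measurable_pi_apply _)

instance (M : MDP S A) (π : PolicyFamily S ν d) (θ : EuclideanSpace ℝ (Fin d)) (n : ℕ) :
    IsMarkovKernel (M.historyKernel π θ n) := by
  unfold historyKernel; infer_instance

/-- The law `p(·|π_θ)` of the trajectory `τ = (s_t, a_t)_{t ≥ 0}`: `s_0 ~ ρ`, `a_t ~ π_θ(·|s_t)`,
`s_{t+1} ~ P(·|s_t, a_t)`. -/
noncomputable def trajLaw (M : MDP S A) (π : PolicyFamily S ν d)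
    (θ : EuclideanSpace ℝ (Fin d)) : Measure (ℕ → S × A) :=
  Kernel.trajMeasure (X := fun _ => S × A) (M.ρ ⊗ₘ π.kernel θ) (M.historyKernel π θ)

/-- The expected return `J(θ)`. -/
noncomputable def J (M : MDP S A) (π : PolicyFamily S ν d) (θ : EuclideanSpace ℝ (Fin d)) : ℝ :=
  ∫ τ, ∑' t : ℕ, M.γ ^ t * M.R (τ t).1 (τ t).2 ∂(M.trajLaw π θ)

/-- The expected return `J_H(θ)` truncated at horizon `H`. -/
noncomputable def truncJ (M : MDP S A) (π : PolicyFamily S ν d) (H : ℕ)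
    (θ : EuclideanSpace ℝ (Fin d)) : ℝ :=
  ∫ τ, ∑ t ∈ range H, M.γ ^ t * M.R (τ t).1 (τ t).2 ∂(M.trajLaw π θ)

/-- The truncated reward-to-go `Ψ_h(τ) = ∑_{t=h}^{H-1} γ^t R(s_t, a_t)`. -/
noncomputable def rewardToGo (M : MDP S A) (H h : ℕ) (τ : ℕ → S × A) : ℝ :=
  ∑ t ∈ Ico h H, M.γ ^ t * M.R (τ t).1 (τ t).2

/-- `E[∑_{h=0}^{H-1} Ψ_h(τ) ∇ log π_θ(a_h|s_h)]`. -/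
noncomputable def truncPolicyGradient (M : MDP S A) (π : PolicyFamily S ν d) (H : ℕ)
    (θ : EuclideanSpace ℝ (Fin d)) : EuclideanSpace ℝ (Fin d) :=
  ∫ τ, ∑ h ∈ range H, M.rewardToGo H h τ • gradient (π.logDens (τ h).1 (τ h).2) θ
    ∂(M.trajLaw π θ)

/-- `Φ(θ; τ) = ∑_{h=0}^{H-1} ∑_{t=h}^{H-1} γ^t R(s_t, a_t) log π_θ(a_h|s_h)`. -/
noncomputable def truncPhi (M : MDP S A) (π : PolicyFamily S ν d) (H : ℕ) (τ : ℕ → S × A)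
    (θ : EuclideanSpace ℝ (Fin d)) : ℝ :=
  ∑ h ∈ range H, ∑ t ∈ Ico h H,
    M.γ ^ t * M.R (τ t).1 (τ t).2 * π.logDens (τ h).1 (τ h).2 θ

/-- The score `∇ log p(τ|π_θ)` of the trajectory truncated at horizon `H`; only the policy factors
of `p(τ|π_θ)` depend on `θ`. -/
noncomputable def truncScore (π : PolicyFamily S ν d) (H : ℕ) (τ : ℕ → S × A)
    (θ : EuclideanSpace ℝ (Fin d)) : EuclideanSpace ℝ (Fin d) :=
  ∑ h ∈ range H, gradient (π.logDens (τ h).1 (τ h).2) θ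

/-- `E[∇Φ(θ; τ) ∇ log p(τ|π_θ)ᵀ + ∇²Φ(θ; τ)]`; here `x yᵀ` is the operator `v ↦ ⟨y, v⟩ x`. -/
noncomputable def truncPolicyHessian (M : MDP S A) (π : PolicyFamily S ν d) (H : ℕ)
    (θ : EuclideanSpace ℝ (Fin d)) :
    EuclideanSpace ℝ (Fin d) →L[ℝ] EuclideanSpace ℝ (Fin d) :=
  ∫ τ, InnerProductSpace.rankOne ℝ (gradient (M.truncPhi π H τ) θ) (truncScore π H τ θ) +
    hessian (M.truncPhi π H τ) θ ∂(M.trajLaw π θ)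

end MDP

/-! The law of the first `n` state-action pairs depends on `θ` only through the policy factors.
Under two parameters these laws have density ratio `∏ π_θ(a_h|s_h) / π_θ'(a_h|s_h)`, because the
initial law and the transitions cancel (`lintegral_trajLaw_eq`, `integral_trajLaw_eq`). An
expectation can therefore be written under a fixed law `θ₀` and differentiated under the integral;
at `θ = θ₀` the ratio is 1 and its gradient is the score `X_n = ∑_{h<n} ∇ log π_θ(a_h|s_h)`
(`hasFDerivAt_integral_trajLaw`). Since `R(s_t, a_t)` involves only `t + 1` pairs, two applications
give its expectation the gradient `E[R X_{t+1}]` and the Hessian `E[R (∇X_{t+1} + X_{t+1}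
X_{t+1}ᵀ)]`.

Each score has mean zero given the earlier pairs (`integral_smul_score_eq_zero`). This removes past
rewards from the policy gradient, and it makes the scores uncorrelated, so that `E‖X_n‖² ≤ n G₁²` is
linear in `n` instead of quadratic (`integral_norm_truncScore_sq_le`).

Hence the Hessian of the `t`-th expected reward is of order `t + 1` and its gradient of order `√(t +
1)`. Discounting makes the differentiated series converge uniformly in `θ`, so `J` is twice
differentiable term by term and the truncation errors are tails of these series. The square root in
`D_g` comes from bounding `E‖X‖` by `(E‖X‖² + c²) / (2c)` with one `c` for all `t`, optimized after
the summation. -/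

/-- The sequence that agrees with `y` up to time `a` and is constantly `x` afterwards. -/
def extendHistory {X : Type*} (a : ℕ) (y : (i : Iic a) → X) (x : X) (i : ℕ) : X :=
  if h : i ≤ a then y ⟨i, mem_Iic.2 h⟩ else x

lemma measurable_extendHistory {X : Type*} [MeasurableSpace X] (a : ℕ) :
    Measurable fun p : ((i : Iic a) → X) × X => extendHistory a p.1 p.2 := by
  refine measurable_pi_lambda _ fun i => ?_
  unfold extendHistory
  split_ifs <;> fun_prop

lemma extendHistory_of_le {X : Type*} {a i : ℕ} (h : i ≤ a) (τ : ℕ → X) (x : X) :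
    extendHistory a (Preorder.frestrictLe a τ) x i = τ i := by
  simp [extendHistory, h, Preorder.frestrictLe]

lemma extendHistory_of_lt {X : Type*} {a i : ℕ} (h : a < i) (y : (i : Iic a) → X) (x : X) :
    extendHistory a y x i = x := by
  simp [extendHistory, h]

/-- The history up to time `a` and the next pair fill the times `0, ..., a + 1`, which is all that
`f` sees; the constant continuation is irrelevant. -/
lemma DependsOn.extendHistory_eq {X β : Type*} {f : (ℕ → X) → β} {a : ℕ}
    (hf : DependsOn f (Set.Iio (a + 2))) (τ : ℕ → X) :
    f (extendHistory a (Preorder.frestrictLe a τ) (τ (a + 1))) = f τ := by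
  refine hf fun i hi => ?_
  rcases Nat.lt_or_ge a i with h | h
  · have : i = a + 1 := by simp only [Set.mem_Iio] at hi; omega
    rw [extendHistory_of_lt h, this]
  · exact extendHistory_of_le h _ _

lemma DependsOn.mono_Iio {X β : Type*} {f : (ℕ → X) → β} {m n : ℕ}
    (hf : DependsOn f (Set.Iio m)) (h : m ≤ n) : DependsOn f (Set.Iio n) :=
  hf.mono (Set.Iio_subset_Iio h)

/-! ### Likelihood ratios and change of measure -/

namespace MDP

variable {S A : Type*} [MeasurableSpace S] [MeasurableSpace A] {ν : Measure A} {d : ℕ}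

/-- The likelihood ratio `π_θ(a|s) / π_θ'(a|s)`. -/
noncomputable def stepRatio (π : PolicyFamily S ν d) (θ θ' : EuclideanSpace ℝ (Fin d))
    (x : S × A) : ENNReal :=
  ENNReal.ofReal (π.dens θ x.1 x.2 / π.dens θ' x.1 x.2)

lemma measurable_stepRatio (π : PolicyFamily S ν d) (θ θ' : EuclideanSpace ℝ (Fin d)) :
    Measurable (stepRatio π θ θ') :=
  ENNReal.measurable_ofReal.comp ((π.measurable_dens θ).div (π.measurable_dens θ'))

/-- The likelihood ratio of the first `n` state-action pairs of a trajectory. -/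
noncomputable def trajRatio (π : PolicyFamily S ν d) (θ θ' : EuclideanSpace ℝ (Fin d)) (n : ℕ)
    (τ : ℕ → S × A) : ENNReal :=
  ∏ h ∈ range n, stepRatio π θ θ' (τ h)

lemma measurable_trajRatio (π : PolicyFamily S ν d) (θ θ' : EuclideanSpace ℝ (Fin d)) (n : ℕ) :
    Measurable (trajRatio π θ θ' n) :=
  Finset.measurable_fun_prod _ fun h _ => (measurable_stepRatio π θ θ').comp (measurable_pi_apply h)

lemma dependsOn_trajRatio (π : PolicyFamily S ν d) (θ θ' : EuclideanSpace ℝ (Fin d)) (n : ℕ) :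
    DependsOn (trajRatio π θ θ' n) (Set.Iio n) := fun x y h =>
  Finset.prod_congr rfl fun i hi => by rw [h i (by simpa using hi)]

variable [SigmaFinite ν]

instance (M : MDP S A) (π : PolicyFamily S ν d) (θ : EuclideanSpace ℝ (Fin d)) :
    IsProbabilityMeasure (M.trajLaw π θ) := by
  unfold trajLaw; infer_instance

lemma map_frestrictLe_trajLaw_compProd (M : MDP S A) (π : PolicyFamily S ν d)
    (θ : EuclideanSpace ℝ (Fin d)) (a : ℕ) :
    (M.trajLaw π θ).map (Preorder.frestrictLe a) ⊗ₘ M.historyKernel π θ a =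
      (M.trajLaw π θ).map fun x => (Preorder.frestrictLe a x, x (a + 1)) :=
  Kernel.map_frestrictLe_trajMeasure_compProd_eq_map_trajMeasure (X := fun _ => S × A)

lemma map_eval_zero_trajLaw (M : MDP S A) (π : PolicyFamily S ν d)
    (θ : EuclideanSpace ℝ (Fin d)) :
    (M.trajLaw π θ).map (fun τ => τ 0) = M.ρ ⊗ₘ π.kernel θ := by
  have h0 : (fun τ : ℕ → S × A => τ 0) =
      (fun y : (i : Iic 0) → S × A => y ⟨0, mem_Iic.2 le_rfl⟩) ∘ Preorder.frestrictLe 0 := rfl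
  rw [h0, ← Measure.map_map (by fun_prop) (by fun_prop), trajLaw, Kernel.trajMeasure,
    Measure.map_comp _ _ (by fun_prop), Kernel.traj_map_frestrictLe, Kernel.partialTraj_self,
    Measure.id_comp, Measure.map_map (by fun_prop) (by fun_prop)]
  exact Measure.map_id

/-- The value of `f` at time `a + 1` integrated over the last transition. -/
lemma lintegral_trajLaw_succ (M : MDP S A) (π : PolicyFamily S ν d)
    (θ : EuclideanSpace ℝ (Fin d)) (a : ℕ) {f : (ℕ → S × A) → ENNReal} (hf : Measurable f)
    (hd : DependsOn f (Set.Iio (a + 2))) :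
    ∫⁻ τ, f τ ∂(M.trajLaw π θ) = ∫⁻ τ, ∫⁻ x,
      f (extendHistory a (Preorder.frestrictLe a τ) x) ∂(M.stepKernel π θ (τ a))
        ∂(M.trajLaw π θ) := by
  have hm : Measurable fun p : ((i : Iic a) → S × A) × (S × A) => f (extendHistory a p.1 p.2) :=
    hf.comp (measurable_extendHistory a)
  have h1 : Measurable fun τ : ℕ → S × A =>
      (Preorder.frestrictLe (π := fun _ => S × A) a τ, τ (a + 1)) :=
    (Preorder.measurable_frestrictLe a).prodMk (measurable_pi_apply _)
  have h2 := lintegral_map (μ := M.trajLaw π θ) hm h1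
  rw [← map_frestrictLe_trajLaw_compProd, Measure.lintegral_compProd hm,
    lintegral_map hm.lintegral_kernel_prod_right' (by fun_prop)] at h2
  simp only [hd.extendHistory_eq] at h2
  rw [← h2]
  rfl

/-- Both action laws have densities with respect to `ν`, and positivity of the denominator lets it
cancel. -/
lemma lintegral_policyKernel_eq (π : PolicyFamily S ν d) (θ θ' : EuclideanSpace ℝ (Fin d))
    (hpos : ∀ θ s a, 0 < π.dens θ s a) (s : S) {g : A → ENNReal} (hg : Measurable g) :
    ∫⁻ a, g a ∂(π.kernel θ s) = ∫⁻ a, stepRatio π θ θ' (s, a) * g a ∂(π.kernel θ' s) := by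
  have hm : ∀ θ, Measurable (Function.uncurry fun s a => ENNReal.ofReal (π.dens θ s a)) :=
    fun θ => ENNReal.measurable_ofReal.comp (π.measurable_dens θ)
  have hr : Measurable fun a => stepRatio π θ θ' (s, a) :=
    (measurable_stepRatio π θ θ').comp measurable_prodMk_left
  rw [PolicyFamily.kernel, PolicyFamily.kernel, Kernel.lintegral_withDensity _ (hm θ) _ hg,
    Kernel.lintegral_withDensity _ (hm θ') _ (g := fun a => stepRatio π θ θ' (s, a) * g a)
      (hr.mul hg)]
  refine lintegral_congr fun a => ?_
  rw [← mul_assoc, stepRatio, ← ENNReal.ofReal_mul (hpos θ' s a).le,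
    mul_div_cancel₀ _ (hpos θ' s a).ne']

/-- The transition kernel `P` is common to both policies, so only the action factor contributes to
the ratio. -/
lemma lintegral_stepKernel_eq (M : MDP S A) (π : PolicyFamily S ν d)
    (θ θ' : EuclideanSpace ℝ (Fin d)) (hpos : ∀ θ s a, 0 < π.dens θ s a) (z : S × A)
    {g : S × A → ENNReal} (hg : Measurable g) :
    ∫⁻ x, g x ∂(M.stepKernel π θ z) = ∫⁻ x, stepRatio π θ θ' x * g x ∂(M.stepKernel π θ' z) := by
  rw [stepKernel, stepKernel, Kernel.lintegral_compProd _ _ _ hg,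
    Kernel.lintegral_compProd _ _ _ (f := fun x => stepRatio π θ θ' x * g x)
      ((measurable_stepRatio π θ θ').mul hg)]
  refine lintegral_congr fun s => ?_
  rw [Kernel.lintegral_prodMkLeft, Kernel.lintegral_prodMkLeft,
    lintegral_policyKernel_eq π θ θ' hpos s (g := fun a => g (s, a))
      (hg.comp measurable_prodMk_left)]

/-- Change of measure for functions of the first `n` state-action pairs. -/
theorem lintegral_trajLaw_eq (M : MDP S A) (π : PolicyFamily S ν d)
    (θ θ' : EuclideanSpace ℝ (Fin d)) (hpos : ∀ θ s a, 0 < π.dens θ s a) (n : ℕ)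
    {f : (ℕ → S × A) → ENNReal} (hf : Measurable f) (hd : DependsOn f (Set.Iio n)) :
    ∫⁻ τ, f τ ∂(M.trajLaw π θ) = ∫⁻ τ, trajRatio π θ θ' n τ * f τ ∂(M.trajLaw π θ') := by
  induction n generalizing f with
  | zero =>
    obtain ⟨τ₀⟩ : Nonempty (ℕ → S × A) := (M.trajLaw π θ).nonempty_of_neZero
    have : f = fun _ => f τ₀ := funext fun τ => hd fun i hi => by simp at hi
    rw [this]
    simp [trajRatio]
  | succ a ih =>
    -- The first pair comes from the initial law rather than from a transition, so one pair is a
    -- separate case.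
    cases a with
    | zero =>
      have hconst : ∀ τ, f τ = f fun _ => τ 0 := fun τ => hd fun i hi => by
        have : i = 0 := by simpa using hi
        rw [this]
      have hm : Measurable fun x : S × A => f fun _ => x :=
        hf.comp (measurable_pi_lambda _ fun _ => measurable_id)
      have key : ∀ θ (g : S × A → ENNReal), Measurable g → ∫⁻ τ, g (τ 0) ∂(M.trajLaw π θ) =
          ∫⁻ s, ∫⁻ a, g (s, a) ∂(π.kernel θ s) ∂M.ρ := fun θ g hg => by
        rw [← Measure.lintegral_compProd hg, ← map_eval_zero_trajLaw,
          lintegral_map hg (measurable_pi_apply 0)]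
      have e1 : ∫⁻ τ, f τ ∂(M.trajLaw π θ) = ∫⁻ τ, (fun x => f fun _ => x) (τ 0) ∂(M.trajLaw π θ) :=
        lintegral_congr hconst
      have e2 : ∫⁻ τ, trajRatio π θ θ' (0 + 1) τ * f τ ∂(M.trajLaw π θ') =
          ∫⁻ τ, (fun x => stepRatio π θ θ' x * f fun _ => x) (τ 0) ∂(M.trajLaw π θ') :=
        lintegral_congr fun τ => by simp [trajRatio, hconst τ]
      rw [e1, e2, key _ _ hm, 
        key θ' (fun x => stepRatio π θ θ' x * f fun _ => x) ((measurable_stepRatio π θ θ').mul hm)]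
      refine lintegral_congr fun s => ?_
      exact lintegral_policyKernel_eq π θ θ' hpos s (hm.comp measurable_prodMk_left)
    | succ a =>
      have hres : Measurable fun p : (ℕ → S × A) × (S × A) =>
          (Preorder.frestrictLe (π := fun _ => S × A) a p.1, p.2) :=
        ((Preorder.measurable_frestrictLe a).comp measurable_fst).prodMk measurable_snd
      have hm : Measurable fun p : (ℕ → S × A) × (S × A) =>
          f (extendHistory a (Preorder.frestrictLe a p.1) p.2) :=
        (hf.comp (measurable_extendHistory a)).comp hres
      have hr : Measurable fun p : (ℕ → S × A) × (S × A) => stepRatio π θ θ' p.2 :=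
        (measurable_stepRatio π θ θ').comp measurable_snd
      have hstep : ∀ τ : ℕ → S × A, ∫⁻ x, f (extendHistory a (Preorder.frestrictLe a τ) x)
          ∂(M.stepKernel π θ (τ a)) = ∫⁻ x, stepRatio π θ θ' x *
            f (extendHistory a (Preorder.frestrictLe a τ) x) ∂(M.stepKernel π θ' (τ a)) :=
        fun τ => lintegral_stepKernel_eq M π θ θ' hpos _ (hm.comp measurable_prodMk_left)
      rw [lintegral_trajLaw_succ M π θ a hf hd,
        lintegral_trajLaw_succ M π θ' a (f := fun τ => trajRatio π θ θ' (a + 2) τ * f τ)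
          ((measurable_trajRatio π θ θ' _).mul hf)
          (fun x y h => by
            beta_reduce
            rw [dependsOn_trajRatio π θ θ' _ h, hd h])]
      simp_rw [hstep]
      -- After the last transition is integrated out, the integrand depends on the first `a + 1`
      -- pairs only, and the remaining ratio is that of these pairs.
      rw [ih]
      · refine lintegral_congr fun τ => ?_
        rw [← lintegral_const_mul _ (f := fun x => stepRatio π θ θ' x *
          f (extendHistory a (Preorder.frestrictLe a τ) x))
          ((hr.mul hm).comp measurable_prodMk_left)]
        refine lintegral_congr fun x => ?_
        rw [trajRatio, trajRatio, prod_range_succ _ (a + 1), mul_assoc,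
          extendHistory_of_lt (Nat.lt_succ_self a)]
        congr 1
        refine prod_congr rfl fun i hi => ?_
        rw [extendHistory_of_le (by simpa [Nat.lt_succ_iff] using hi)]
      · have := (hr.mul hm).lintegral_kernel_prod_right'
          (κ := (M.stepKernel π θ').comap (fun τ : ℕ → S × A => τ a) (measurable_pi_apply a))
        exact this
      · intro x y h
        have hxy : Preorder.frestrictLe (π := fun _ => S × A) a x = Preorder.frestrictLe a y :=
          funext fun i => h i.1 (Nat.lt_succ_of_le (mem_Iic.1 i.2))
        simp only [hxy, h a (Nat.lt_succ_self a)]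

/-- Change of measure for Bochner integrals of functions of the first `n` state-action pairs. -/
theorem integral_trajLaw_eq (M : MDP S A) (π : PolicyFamily S ν d)
    (θ θ' : EuclideanSpace ℝ (Fin d)) (hpos : ∀ θ s a, 0 < π.dens θ s a) (n : ℕ)
    {F : Type*} [NormedAddCommGroup F] [NormedSpace ℝ F]
    {f : (ℕ → S × A) → F} (hf : StronglyMeasurable f) (hd : DependsOn f (Set.Iio n)) :
    ∫ τ, f τ ∂(M.trajLaw π θ) = ∫ τ, (trajRatio π θ θ' n τ).toReal • f τ ∂(M.trajLaw π θ') := by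
  obtain ⟨τ₀⟩ : Nonempty (ℕ → S × A) := (M.trajLaw π θ).nonempty_of_neZero
  -- The two measures agree only on the first `n` coordinates. Freezing the later ones through `T`
  -- turns this into an equality of image measures, which then serves vector-valued integrands.
  let T : (ℕ → S × A) → ℕ → S × A := fun τ i => if i < n then τ i else τ₀ i
  have hT : Measurable T := measurable_pi_lambda _ fun i => by
    by_cases h : i < n
    · simpa only [T, h, if_true] using measurable_pi_apply i
    · simpa only [T, h, if_false] using measurable_const
  have hTd : DependsOn T (Set.Iio n) := fun x y h => funext fun i => by
    by_cases hi : i < n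
    · simp [T, hi, h i hi]
    · simp [T, hi]
  have hfT : ∀ τ, f (T τ) = f τ := fun τ => hd fun i hi => if_pos hi
  have hmap : (M.trajLaw π θ).map T =
      ((M.trajLaw π θ').withDensity (trajRatio π θ θ' n)).map T := by
    refine Measure.ext_of_lintegral _ fun g hg => ?_
    rw [lintegral_map hg hT, lintegral_map hg hT,
      lintegral_withDensity_eq_lintegral_mul _ (measurable_trajRatio π θ θ' n)
        (g := fun τ => g (T τ)) (hg.comp hT),
      lintegral_trajLaw_eq M π θ θ' hpos n (f := fun τ => g (T τ)) (hg.comp hT)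
        fun x y h => congrArg g (hTd h)]
    rfl
  have h1 : ∀ μ : Measure (ℕ → S × A), ∫ τ, f τ ∂μ = ∫ τ, f τ ∂(μ.map T) := fun μ => by
    rw [integral_map hT.aemeasurable hf.aestronglyMeasurable]
    simp_rw [hfT]
  rw [h1, hmap, ← h1, integral_withDensity_eq_integral_toReal_smul (measurable_trajRatio π θ θ' n)]
  exact ae_of_all _ fun τ => ENNReal.prod_lt_top fun i _ => ENNReal.ofReal_lt_top

end MDP

/-! ### Integrability and measurability of derivatives in a parameter -/

lemma integrable_of_bound {X F : Type*} [MeasurableSpace X] [NormedAddCommGroup F] {μ : Measure X}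
    [IsFiniteMeasure μ] {f : X → F} (hf : StronglyMeasurable f) {C : ℝ} (h : ∀ x, ‖f x‖ ≤ C) :
    Integrable f μ :=
  .of_bound hf.aestronglyMeasurable C (ae_of_all _ h)

section Measurability

variable {X E F : Type*} [MeasurableSpace X] [NormedAddCommGroup E] [InnerProductSpace ℝ E]
  [FiniteDimensional ℝ E] [NormedAddCommGroup F] [NormedSpace ℝ F]

/-- In finite dimension an operator is a finite sum of rank-one operators built from its values on a
basis. -/
lemma stronglyMeasurable_clm_of_apply {L : X → E →L[ℝ] F}
    (h : ∀ v, StronglyMeasurable fun x => L x v) : StronglyMeasurable L := by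
  let b := stdOrthonormalBasis ℝ E
  have hL : L = fun x => ∑ i, (innerSL ℝ (b i)).smulRight (L x (b i)) := by
    ext x v
    conv_lhs => rw [← b.sum_repr' v]
    simp
  rw [hL]
  exact Finset.stronglyMeasurable_fun_sum _ fun i _ =>
    (ContinuousLinearMap.smulRightL ℝ E F (innerSL ℝ (b i))).continuous.comp_stronglyMeasurable
      (h (b i))

/-- Each directional derivative is a pointwise limit of difference quotients, which are measurable
in `x`. -/
lemma stronglyMeasurable_fderiv_param {f : E → X → F} (hf : ∀ θ, StronglyMeasurable (f θ)) {θ : E}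
    (hd : ∀ x, DifferentiableAt ℝ (fun θ => f θ x) θ) :
    StronglyMeasurable fun x => fderiv ℝ (fun θ => f θ x) θ := by
  refine stronglyMeasurable_clm_of_apply fun v => ?_
  refine stronglyMeasurable_of_tendsto (Filter.atTop : Filter ℝ)
    (f := fun c x => c • (f (θ + c⁻¹ • v) x - f θ x))
    (fun c => ((hf _).sub (hf _)).const_smul c) ?_
  exact tendsto_pi_nhds.2 fun x => (hd x).hasFDerivAt.lim_real v

end Measurability

/-! ### Regularity of the log-density -/

namespace PolicyFamily

variable {S A : Type*} [MeasurableSpace S] [MeasurableSpace A] {ν : Measure A} {d : ℕ}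
  {π : PolicyFamily S ν d} {G₁ G₂ : ℝ}

local notation "𝔼" => EuclideanSpace ℝ (Fin d)

lemma LS.differentiable_logDens (hLS : π.LS G₁ G₂) (s : S) (a : A) :
    Differentiable ℝ (π.logDens s a) := fun θ =>
  (π.differentiable_dens s a θ).log (hLS.dens_pos θ s a).ne'

lemma LS.hasGradientAt_logDens (hLS : π.LS G₁ G₂) (s : S) (a : A) (θ : 𝔼) :
    HasGradientAt (π.logDens s a) (gradient (π.logDens s a) θ) θ :=
  (hLS.differentiable_logDens s a θ).hasGradientAt

lemma LS.hasFDerivAt_gradient (hLS : π.LS G₁ G₂) (s : S) (a : A) (θ : 𝔼) :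
    HasFDerivAt (gradient (π.logDens s a)) (hessian (π.logDens s a) θ) θ :=
  (hLS.differentiable_gradient s a θ).hasFDerivAt

lemma LS.stronglyMeasurable_gradient (hLS : π.LS G₁ G₂) (θ : 𝔼) :
    StronglyMeasurable fun x : S × A => gradient (π.logDens x.1 x.2) θ :=
  (InnerProductSpace.toDual ℝ 𝔼).symm.continuous.comp_stronglyMeasurable
    (stronglyMeasurable_fderiv_param (f := fun θ (x : S × A) => π.logDens x.1 x.2 θ)
      (fun θ => (Real.measurable_log.comp (π.measurable_dens θ)).stronglyMeasurable)
      fun x => hLS.differentiable_logDens x.1 x.2 θ)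

lemma LS.stronglyMeasurable_hessian (hLS : π.LS G₁ G₂) (θ : 𝔼) :
    StronglyMeasurable fun x : S × A => hessian (π.logDens x.1 x.2) θ :=
  stronglyMeasurable_fderiv_param (f := fun θ (x : S × A) => gradient (π.logDens x.1 x.2) θ)
    hLS.stronglyMeasurable_gradient fun x => hLS.differentiable_gradient x.1 x.2 θ

/-- Mean value inequality. It bounds the likelihood ratios uniformly over trajectories for `θ` near
`θ'`, as dominated differentiation requires. -/
lemma LS.abs_logDens_sub_le (hLS : π.LS G₁ G₂) (s : S) (a : A) (θ θ' : 𝔼) :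
    |π.logDens s a θ - π.logDens s a θ'| ≤ G₁ * ‖θ - θ'‖ := by
  refine Convex.norm_image_sub_le_of_norm_fderiv_le (𝕜 := ℝ) (s := Set.univ)
    (fun x _ => hLS.differentiable_logDens s a x) (fun x _ => ?_) convex_univ
    (Set.mem_univ _) (Set.mem_univ _)
  rw [← toDual_gradient, LinearIsometryEquiv.norm_map]
  exact hLS.norm_gradient_le x s a

end PolicyFamily

/-! ### Scores, their moments and the score function identity -/

namespace MDP

variable {S A : Type*} [MeasurableSpace S] [MeasurableSpace A] {ν : Measure A} {d : ℕ}
  {π : PolicyFamily S ν d} {G₁ G₂ : ℝ}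

local notation "𝔼" => EuclideanSpace ℝ (Fin d)

/-- The derivative of the score in the parameter. -/
noncomputable def truncScoreDeriv (π : PolicyFamily S ν d) (n : ℕ) (τ : ℕ → S × A) (θ : 𝔼) :
    𝔼 →L[ℝ] 𝔼 :=
  ∑ h ∈ range n, hessian (π.logDens (τ h).1 (τ h).2) θ

lemma stronglyMeasurable_truncScore (hLS : π.LS G₁ G₂) (n : ℕ) (θ : 𝔼) :
    StronglyMeasurable fun τ => truncScore π n τ θ :=
  Finset.stronglyMeasurable_fun_sum _ fun h _ =>
    (hLS.stronglyMeasurable_gradient θ).comp_measurable (measurable_pi_apply h)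

lemma stronglyMeasurable_truncScoreDeriv (hLS : π.LS G₁ G₂) (n : ℕ) (θ : 𝔼) :
    StronglyMeasurable fun τ => truncScoreDeriv π n τ θ :=
  Finset.stronglyMeasurable_fun_sum _ fun h _ =>
    (hLS.stronglyMeasurable_hessian θ).comp_measurable (measurable_pi_apply h)

lemma norm_truncScore_le (hLS : π.LS G₁ G₂) (n : ℕ) (τ : ℕ → S × A) (θ : 𝔼) :
    ‖truncScore π n τ θ‖ ≤ n * G₁ := by
  simpa [truncScore] using
    norm_sum_le_of_le (range n) fun h _ => hLS.norm_gradient_le θ (τ h).1 (τ h).2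

lemma norm_truncScoreDeriv_le (hLS : π.LS G₁ G₂) (n : ℕ) (τ : ℕ → S × A) (θ : 𝔼) :
    ‖truncScoreDeriv π n τ θ‖ ≤ n * G₂ := by
  simpa [truncScoreDeriv] using
    norm_sum_le_of_le (range n) fun h _ => hLS.norm_hessian_le θ (τ h).1 (τ h).2

lemma dependsOn_truncScore (n : ℕ) (θ : 𝔼) :
    DependsOn (fun τ => truncScore π n τ θ) (Set.Iio n) := fun x y h =>
  Finset.sum_congr rfl fun i hi => by rw [h i (by simpa using hi)]

lemma hasFDerivAt_truncScore (hLS : π.LS G₁ G₂) (n : ℕ) (τ : ℕ → S × A) (θ : 𝔼) :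
    HasFDerivAt (truncScore π n τ) (truncScoreDeriv π n τ θ) θ :=
  HasFDerivAt.fun_sum fun h _ => hLS.hasFDerivAt_gradient (τ h).1 (τ h).2 θ

lemma toReal_trajRatio (hLS : π.LS G₁ G₂) (n : ℕ) (θ θ' : 𝔼) (τ : ℕ → S × A) :
    (trajRatio π θ θ' n τ).toReal = Real.exp (∑ h ∈ range n,
      (π.logDens (τ h).1 (τ h).2 θ - π.logDens (τ h).1 (τ h).2 θ')) := by
  rw [trajRatio, ENNReal.toReal_prod, Real.exp_sum]
  refine prod_congr rfl fun h _ => ?_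
  have h1 := hLS.dens_pos θ (τ h).1 (τ h).2
  have h2 := hLS.dens_pos θ' (τ h).1 (τ h).2
  rw [stepRatio, ENNReal.toReal_ofReal (by positivity), PolicyFamily.logDens,
    PolicyFamily.logDens, Real.exp_sub, Real.exp_log h1, Real.exp_log h2]

lemma toReal_trajRatio_le (hLS : π.LS G₁ G₂) (n : ℕ) (θ θ' : 𝔼) (τ : ℕ → S × A) :
    (trajRatio π θ θ' n τ).toReal ≤ Real.exp (n * (G₁ * ‖θ - θ'‖)) := by
  rw [toReal_trajRatio hLS, Real.exp_le_exp]
  have := sum_le_card_nsmul (range n) (fun h => π.logDens (τ h).1 (τ h).2 θ -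
    π.logDens (τ h).1 (τ h).2 θ') _ fun h _ =>
      (le_abs_self _).trans (hLS.abs_logDens_sub_le (τ h).1 (τ h).2 θ θ')
  simpa using this

lemma hasFDerivAt_toReal_trajRatio (hLS : π.LS G₁ G₂) (n : ℕ) (θ θ' : 𝔼) (τ : ℕ → S × A) :
    HasFDerivAt (fun θ => (trajRatio π θ θ' n τ).toReal)
      ((trajRatio π θ θ' n τ).toReal • innerSL ℝ (truncScore π n τ θ)) θ := by
  simp_rw [toReal_trajRatio hLS]
  refine HasFDerivAt.exp ?_
  have : innerSL ℝ (truncScore π n τ θ) = ∑ h ∈ range n,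
      innerSL ℝ (gradient (π.logDens (τ h).1 (τ h).2) θ) := by simp [truncScore]
  rw [this]
  exact HasFDerivAt.fun_sum fun h _ =>
    (hasGradientAt_iff_hasFDerivAt.1 (hLS.hasGradientAt_logDens _ _ θ)).sub_const _

lemma toReal_trajRatio_self (hLS : π.LS G₁ G₂) (n : ℕ) (θ : 𝔼) (τ : ℕ → S × A) :
    (trajRatio π θ θ n τ).toReal = 1 := by
  simp [toReal_trajRatio hLS]

/-- The score function identity: the derivative of the expectation of a bounded function of the
first `n` state-action pairs that may itself depend on the parameter. -/
theorem hasFDerivAt_integral_trajLaw [SigmaFinite ν] (M : MDP S A) (hLS : π.LS G₁ G₂) (n : ℕ)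
    {F : Type*} [NormedAddCommGroup F] [NormedSpace ℝ F] {Z : 𝔼 → (ℕ → S × A) → F}
    {Z' : 𝔼 → (ℕ → S × A) → 𝔼 →L[ℝ] F} {C C' : ℝ}
    (hZm : ∀ θ, StronglyMeasurable (Z θ)) (hZd : ∀ θ, DependsOn (Z θ) (Set.Iio n))
    (hZb : ∀ θ τ, ‖Z θ τ‖ ≤ C) (hZm' : ∀ θ, StronglyMeasurable (Z' θ))
    (hZb' : ∀ θ τ, ‖Z' θ τ‖ ≤ C')
    (hderiv : ∀ θ τ, HasFDerivAt (fun θ => Z θ τ) (Z' θ τ) θ) (θ₀ : 𝔼) :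
    HasFDerivAt (fun θ => ∫ τ, Z θ τ ∂(M.trajLaw π θ))
      (∫ τ, Z' θ₀ τ + (innerSL ℝ (truncScore π n τ θ₀)).smulRight (Z θ₀ τ)
        ∂(M.trajLaw π θ₀)) θ₀ := by
  have hchange : (fun θ => ∫ τ, Z θ τ ∂(M.trajLaw π θ)) =
      fun θ => ∫ τ, (trajRatio π θ θ₀ n τ).toReal • Z θ τ ∂(M.trajLaw π θ₀) := funext fun θ =>
    integral_trajLaw_eq M π θ θ₀ hLS.dens_pos n (hZm θ) (hZd θ)
  have hLm : ∀ θ, StronglyMeasurable fun τ => (trajRatio π θ θ₀ n τ).toReal := fun θ =>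
    (measurable_trajRatio π θ θ₀ n).ennreal_toReal.stronglyMeasurable
  have hSm : StronglyMeasurable fun τ =>
      (innerSL ℝ (truncScore π n τ θ₀)).smulRight (Z θ₀ τ) := by
    have h1 : StronglyMeasurable fun τ => innerSL ℝ (truncScore π n τ θ₀) :=
      (innerSL ℝ).continuous.comp_stronglyMeasurable (stronglyMeasurable_truncScore hLS n θ₀)
    have h2 : Continuous fun p : (𝔼 →L[ℝ] ℝ) × F => p.1.smulRight p.2 :=
      (ContinuousLinearMap.smulRightL ℝ 𝔼 F).continuous₂
    exact h2.comp_stronglyMeasurable (h1.prodMk (hZm θ₀))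
  rw [hchange]
  have key := hasFDerivAt_integral_of_dominated_of_fderiv_le (μ := M.trajLaw π θ₀) (x₀ := θ₀)
    (F := fun θ τ => (trajRatio π θ θ₀ n τ).toReal • Z θ τ)
    (F' := fun θ τ => (trajRatio π θ θ₀ n τ).toReal • (Z' θ τ +
      (innerSL ℝ (truncScore π n τ θ)).smulRight (Z θ τ)))
    -- On the unit ball around `θ₀` the ratio is at most `exp (n G₁)`; the other factor bounds `Z'`
    -- plus the score, of norm at most `n G₁`, times `Z`.
    (bound := fun _ => Real.exp (n * (G₁ * 1)) * (C' + n * G₁ * C))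
    (Metric.ball_mem_nhds θ₀ one_pos)
    (.of_forall fun θ => ((hLm θ).smul (hZm θ)).aestronglyMeasurable) ?_ ?_ ?_
    (integrable_const _) ?_
  · simpa only [toReal_trajRatio_self hLS, one_smul] using key
  · simp only [toReal_trajRatio_self hLS, one_smul]
    exact integrable_of_bound (hZm θ₀) (hZb θ₀)
  · exact ((hLm θ₀).smul ((hZm' θ₀).add hSm)).aestronglyMeasurable
  · refine ae_of_all _ fun τ θ hθ => ?_
    have hθ' : ‖θ - θ₀‖ ≤ 1 := (mem_ball_iff_norm.1 hθ).le
    have hG := hLS.G₁_pos.le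
    rw [norm_smul, Real.norm_of_nonneg ENNReal.toReal_nonneg]
    refine mul_le_mul ((toReal_trajRatio_le hLS n θ θ₀ τ).trans ?_) ?_ (norm_nonneg _)
      (Real.exp_pos _).le
    · gcongr
    · refine (norm_add_le _ _).trans (add_le_add (hZb' θ τ) ?_)
      rw [ContinuousLinearMap.norm_smulRight_apply, innerSL_apply_norm]
      exact mul_le_mul (norm_truncScore_le hLS n τ θ) (hZb θ τ) (norm_nonneg _) (by positivity)
  · refine ae_of_all _ fun τ θ _ => ?_
    have := (hasFDerivAt_toReal_trajRatio hLS n θ θ₀ τ).fun_smul (hderiv θ τ)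
    convert this using 1
    ext v
    simp [smul_smul]

variable [SigmaFinite ν]

lemma integrable_smul_truncScore (M : MDP S A) (hLS : π.LS G₁ G₂) (n : ℕ)
    {Z : (ℕ → S × A) → ℝ} {C : ℝ} (hZm : StronglyMeasurable Z) (hZb : ∀ τ, ‖Z τ‖ ≤ C) (θ : 𝔼) :
    Integrable (fun τ => Z τ • truncScore π n τ θ) (M.trajLaw π θ) := by
  have hC : 0 ≤ C := (norm_nonneg _).trans (hZb (M.trajLaw π θ).nonempty_of_neZero.some)
  refine integrable_of_bound (C := C * (n * G₁))
    (hZm.smul (stronglyMeasurable_truncScore hLS n θ)) fun τ => ?_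
  rw [norm_smul]
  exact mul_le_mul (hZb τ) (norm_truncScore_le hLS n τ θ) (norm_nonneg _) hC

/-- The score-function identity for a bounded real function of the first `n` state-action pairs. -/
theorem hasGradientAt_integral_trajLaw (M : MDP S A) (hLS : π.LS G₁ G₂) (n : ℕ)
    {Z : (ℕ → S × A) → ℝ} {C : ℝ} (hZm : StronglyMeasurable Z) (hZd : DependsOn Z (Set.Iio n))
    (hZb : ∀ τ, ‖Z τ‖ ≤ C) (θ : 𝔼) :
    HasGradientAt (fun θ => ∫ τ, Z τ ∂(M.trajLaw π θ))
      (∫ τ, Z τ • truncScore π n τ θ ∂(M.trajLaw π θ)) θ := by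
  have h := hasFDerivAt_integral_trajLaw M hLS n (Z := fun _ => Z) (Z' := fun _ _ => 0) (C' := 0)
    (fun _ => hZm) (fun _ => hZd) (fun _ => hZb) (fun _ => stronglyMeasurable_const) (by simp)
    (fun θ τ => hasFDerivAt_const _ _) θ
  have heq : InnerProductSpace.toDual ℝ 𝔼 (∫ τ, Z τ • truncScore π n τ θ ∂(M.trajLaw π θ)) =
      ∫ τ, 0 + (innerSL ℝ (truncScore π n τ θ)).smulRight (Z τ) ∂(M.trajLaw π θ) := by
    -- `toDual` is typed as conjugate-linear, hence the semilinear form of exchanging an operator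
    -- with the integral.
    refine ((InnerProductSpace.toDual ℝ 𝔼).toContinuousLinearEquiv.toContinuousLinearMap
      |>.integral_comp_commSL (by simp) ?_).symm.trans
      (integral_congr_ae (ae_of_all _ fun τ => ?_))
    · exact integrable_smul_truncScore M hLS n hZm hZb θ
    · ext v
      simp [mul_comm]
  rwa [hasGradientAt_iff_hasFDerivAt, heq]

/-- The score of a time step has zero mean given the past. -/
theorem integral_smul_score_eq_zero (M : MDP S A) (hLS : π.LS G₁ G₂) (n : ℕ)
    {Z : (ℕ → S × A) → ℝ} {C : ℝ} (hZm : StronglyMeasurable Z) (hZd : DependsOn Z (Set.Iio n))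
    (hZb : ∀ τ, ‖Z τ‖ ≤ C) (θ : 𝔼) :
    ∫ τ, Z τ • gradient (π.logDens (τ n).1 (τ n).2) θ ∂(M.trajLaw π θ) = 0 := by
  -- `Z` also counts as a function of `n + 1` pairs. The gradient computed with either score is the
  -- same, and the two scores differ by the term at time `n`.
  have h := (hasGradientAt_integral_trajLaw M hLS (n + 1) hZm (hZd.mono_Iio n.le_succ)
    hZb θ).unique (hasGradientAt_integral_trajLaw M hLS n hZm hZd hZb θ)
  have hi := fun n => integrable_smul_truncScore M hLS n hZm hZb θ
  rw [← sub_eq_zero, ← integral_sub (hi _) (hi _)] at h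
  rw [← h]
  refine integral_congr_ae (ae_of_all _ fun τ => ?_)
  simp [truncScore, sum_range_succ]

lemma integrable_norm_truncScore_sq (M : MDP S A) (hLS : π.LS G₁ G₂) (n : ℕ) (θ : 𝔼) :
    Integrable (fun τ => ‖truncScore π n τ θ‖ ^ 2) (M.trajLaw π θ) :=
  integrable_of_bound (C := (n * G₁) ^ 2)
    ((stronglyMeasurable_truncScore hLS n θ).norm.pow 2) fun τ => by
      rw [norm_pow, norm_norm]
      gcongr
      exact norm_truncScore_le hLS n τ θ

/-- The scores of different time steps are uncorrelated, so the second moment of the score of a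
trajectory grows linearly. -/
theorem integral_norm_truncScore_sq_le (M : MDP S A) (hLS : π.LS G₁ G₂) (n : ℕ) (θ : 𝔼) :
    ∫ τ, ‖truncScore π n τ θ‖ ^ 2 ∂(M.trajLaw π θ) ≤ n * G₁ ^ 2 := by
  induction n with
  | zero => simp [truncScore]
  | succ n ih =>
    have hG := hLS.G₁_pos.le
    have hSm := stronglyMeasurable_truncScore hLS n θ
    have hsm : StronglyMeasurable fun τ : ℕ → S × A => gradient (π.logDens (τ n).1 (τ n).2) θ :=
      (hLS.stronglyMeasurable_gradient θ).comp_measurable (measurable_pi_apply n)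
    -- Each coordinate of the past score is a bounded function of the first `n` pairs, so it may
    -- serve as `Z` in the zero-mean identity.
    have hcross : ∀ i, ∫ τ, truncScore π n τ θ i * gradient (π.logDens (τ n).1 (τ n).2) θ i
        ∂(M.trajLaw π θ) = 0 := fun i => by
      have hcm : StronglyMeasurable fun τ => truncScore π n τ θ i :=
        (EuclideanSpace.proj (𝕜 := ℝ) i).continuous.comp_stronglyMeasurable hSm
      have hcb : ∀ τ, ‖truncScore π n τ θ i‖ ≤ n * G₁ := fun τ =>
        (PiLp.norm_apply_le _ i).trans (norm_truncScore_le hLS n τ θ)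
      have h := integral_smul_score_eq_zero M hLS n hcm
        (fun x y h => congrArg (fun v : 𝔼 => v i) (dependsOn_truncScore n θ h)) hcb θ
      have hint : Integrable (fun τ => truncScore π n τ θ i •
          gradient (π.logDens (τ n).1 (τ n).2) θ) (M.trajLaw π θ) :=
        integrable_of_bound (C := n * G₁ * G₁) (hcm.smul hsm) fun τ => by
          rw [norm_smul]
          exact mul_le_mul (hcb τ) (hLS.norm_gradient_le θ _ _) (norm_nonneg _) (by positivity)
      have h' := (EuclideanSpace.proj (𝕜 := ℝ) i).integral_comp_comm hint
      rw [h] at h'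
      simpa using h'
    have hmulint : ∀ i, Integrable (fun τ => truncScore π n τ θ i *
        gradient (π.logDens (τ n).1 (τ n).2) θ i) (M.trajLaw π θ) := fun i =>
      integrable_of_bound (C := n * G₁ * G₁)
        (((EuclideanSpace.proj (𝕜 := ℝ) i).continuous.comp_stronglyMeasurable hSm).mul
          ((EuclideanSpace.proj (𝕜 := ℝ) i).continuous.comp_stronglyMeasurable hsm)) fun τ => by
          rw [norm_mul]
          exact mul_le_mul ((PiLp.norm_apply_le _ i).trans (norm_truncScore_le hLS n τ θ))
            ((PiLp.norm_apply_le _ i).trans (hLS.norm_gradient_le θ _ _)) (norm_nonneg _)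
            (by positivity)
    have hle : ∀ τ, ‖truncScore π (n + 1) τ θ‖ ^ 2 ≤ ‖truncScore π n τ θ‖ ^ 2 +
        2 * ∑ i, truncScore π n τ θ i * gradient (π.logDens (τ n).1 (τ n).2) θ i + G₁ ^ 2 :=
      fun τ => by
        have h1 : truncScore π (n + 1) τ θ =
            truncScore π n τ θ + gradient (π.logDens (τ n).1 (τ n).2) θ := sum_range_succ _ _
        have h2 : inner ℝ (truncScore π n τ θ) (gradient (π.logDens (τ n).1 (τ n).2) θ) =
            ∑ i, truncScore π n τ θ i * gradient (π.logDens (τ n).1 (τ n).2) θ i := by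
          rw [PiLp.inner_apply]
          exact sum_congr rfl fun i _ => by simp [mul_comm]
        rw [h1, norm_add_sq_real, h2]
        gcongr
        exact hLS.norm_gradient_le θ _ _
    have hsq := fun n => integrable_norm_truncScore_sq M hLS n θ
    have hsum : Integrable (fun τ => 2 * ∑ i, truncScore π n τ θ i *
        gradient (π.logDens (τ n).1 (τ n).2) θ i) (M.trajLaw π θ) :=
      (integrable_finsetSum _ fun i _ => hmulint i).const_mul 2
    refine (integral_mono (hsq _) (((hsq n).add hsum).add (integrable_const _)) hle).trans ?_
    rw [integral_add' ((hsq n).add hsum) (integrable_const _), integral_add' (hsq n) hsum,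
      integral_const_mul, integral_finsetSum _ fun i _ => hmulint i,
      sum_eq_zero fun i _ => hcross i]
    simp only [mul_zero, add_zero, integral_const, probReal_univ, one_smul]
    push_cast
    linarith

end MDP

/-! ### Tails of arithmetic-geometric series -/

/-- The weights `γ ^ n` have mass `1 / (1 - γ)`, and under their normalization `n + 1` has mean `1 /
(1 - γ)`; the shift adds `H` to it. -/
lemma hasSum_geometric_mul_add {γ : ℝ} (h0 : 0 ≤ γ) (h1 : γ < 1) (H : ℕ) (a b : ℝ) :
    HasSum (fun n : ℕ => γ ^ n * (a * ((n + H : ℕ) + 1) + b))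
      (1 / (1 - γ) * (a * (H + 1 / (1 - γ)) + b)) := by
  have h2 := (hasSum_coe_mul_geometric_of_norm_lt_one
    (by rwa [Real.norm_of_nonneg h0] : ‖γ‖ < 1)).mul_left a
  have h3 := (hasSum_geometric_of_lt_one h0 h1).mul_left (a * (H + 1) + b)
  have h4 : 1 - γ ≠ 0 := by linarith
  have h5 : 1 / (1 - γ) * (a * (H + 1 / (1 - γ)) + b) =
      a * (γ / (1 - γ) ^ 2) + (a * (H + 1) + b) * (1 - γ)⁻¹ := by
    field_simp
    ring
  have h6 : (fun n : ℕ => γ ^ n * (a * ((n + H : ℕ) + 1) + b)) =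
      fun n : ℕ => a * (n * γ ^ n) + (a * (H + 1) + b) * γ ^ n := by
    ext n
    push_cast
    ring
  rw [h5, h6]
  exact h2.add h3

/-- Summability and tail estimate for a series with terms of size `γ ^ n * (a * (n + 1) + b)`. -/
lemma summable_and_norm_tsum_sub_sum_le {V : Type*} [NormedAddCommGroup V] [CompleteSpace V]
    {γ : ℝ} (h0 : 0 ≤ γ) (h1 : γ < 1) {f : ℕ → V} {a b : ℝ}
    (hf : ∀ n, ‖f n‖ ≤ γ ^ n * (a * (n + 1) + b)) (H : ℕ) :
    Summable f ∧ ‖∑' n, f n - ∑ n ∈ range H, f n‖ ≤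
      γ ^ H * (1 / (1 - γ) * (a * (H + 1 / (1 - γ)) + b)) := by
  have hs : Summable f := .of_norm_bounded
    (by simpa using (hasSum_geometric_mul_add h0 h1 0 a b).summable) hf
  refine ⟨hs, ?_⟩
  rw [← hs.sum_add_tsum_nat_add H, add_sub_cancel_left]
  refine tsum_of_norm_bounded ((hasSum_geometric_mul_add h0 h1 H a b).mul_left (γ ^ H))
    fun n => (hf (n + H)).trans_eq ?_
  rw [pow_add]; ring

/-! ### Rewards and the derivatives of `Φ` -/

namespace MDP

variable {S A : Type*} [MeasurableSpace S] [MeasurableSpace A] {ν : Measure A} {d : ℕ}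
  {π : PolicyFamily S ν d} {G₁ G₂ : ℝ}

local notation "𝔼" => EuclideanSpace ℝ (Fin d)

section Reward

variable (M : MDP S A)

lemma stronglyMeasurable_reward (t : ℕ) :
    StronglyMeasurable fun τ : ℕ → S × A => M.R (τ t).1 (τ t).2 :=
  (M.measurable_R.comp (measurable_pi_apply t)).stronglyMeasurable

lemma dependsOn_reward (t : ℕ) :
    DependsOn (fun τ : ℕ → S × A => M.R (τ t).1 (τ t).2) (Set.Iio (t + 1)) := fun x y h => by
  simp only [h t (Nat.lt_succ_self t)]

lemma norm_discounted_reward_le (t : ℕ) (τ : ℕ → S × A) :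
    ‖M.γ ^ t * M.R (τ t).1 (τ t).2‖ ≤ M.γ ^ t * M.Rmax := by
  rw [norm_mul, Real.norm_of_nonneg (pow_nonneg M.γ_pos.le t)]
  exact mul_le_mul_of_nonneg_left (M.abs_R_le _ _) (pow_nonneg M.γ_pos.le t)

lemma stronglyMeasurable_sum_reward (s : Finset ℕ) :
    StronglyMeasurable fun τ : ℕ → S × A => ∑ t ∈ s, M.γ ^ t * M.R (τ t).1 (τ t).2 :=
  Finset.stronglyMeasurable_fun_sum _ fun t _ => (M.stronglyMeasurable_reward t).const_mul _

lemma dependsOn_sum_reward {s : Finset ℕ} {n : ℕ} (hs : ∀ t ∈ s, t < n) :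
    DependsOn (fun τ : ℕ → S × A => ∑ t ∈ s, M.γ ^ t * M.R (τ t).1 (τ t).2) (Set.Iio n) :=
  fun x y h => sum_congr rfl fun t ht => by rw [h t (hs t ht)]

lemma norm_sum_reward_le (s : Finset ℕ) (τ : ℕ → S × A) :
    ‖∑ t ∈ s, M.γ ^ t * M.R (τ t).1 (τ t).2‖ ≤ ∑ t ∈ s, M.γ ^ t * M.Rmax :=
  norm_sum_le_of_le _ fun t _ => M.norm_discounted_reward_le t τ

lemma hasGradientAt_truncPhi (hLS : π.LS G₁ G₂) (H : ℕ) (τ : ℕ → S × A) (θ : 𝔼) :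
    HasGradientAt (M.truncPhi π H τ)
      (∑ h ∈ range H, M.rewardToGo H h τ • gradient (π.logDens (τ h).1 (τ h).2) θ) θ := by
  have hΦ : M.truncPhi π H τ =
      fun θ => ∑ h ∈ range H, M.rewardToGo H h τ * π.logDens (τ h).1 (τ h).2 θ := funext fun θ => by
    simp only [truncPhi, rewardToGo, sum_mul]
  rw [hasGradientAt_iff_hasFDerivAt, hΦ, map_sum]
  refine HasFDerivAt.fun_sum fun h _ => ?_
  simpa using (hasGradientAt_iff_hasFDerivAt.1
    (hLS.hasGradientAt_logDens (τ h).1 (τ h).2 θ)).const_mul (M.rewardToGo H h τ)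

lemma hasFDerivAt_gradient_truncPhi (hLS : π.LS G₁ G₂) (H : ℕ) (τ : ℕ → S × A) (θ : 𝔼) :
    HasFDerivAt (gradient (M.truncPhi π H τ))
      (∑ h ∈ range H, M.rewardToGo H h τ • hessian (π.logDens (τ h).1 (τ h).2) θ) θ := by
  rw [funext fun θ => (M.hasGradientAt_truncPhi hLS H τ θ).gradient]
  exact HasFDerivAt.fun_sum fun h _ => (hLS.hasFDerivAt_gradient _ _ θ).fun_const_smul _

end Reward

variable [SigmaFinite ν]

/-! ### Derivatives of the expected reward at one time -/

section Step

variable (M : MDP S A)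

/-- The expected reward at time `t`. -/
noncomputable def stepJ (π : PolicyFamily S ν d) (t : ℕ) (θ : 𝔼) : ℝ :=
  ∫ τ, M.R (τ t).1 (τ t).2 ∂(M.trajLaw π θ)

/-- The gradient of the expected reward at time `t`. -/
noncomputable def stepGradient (π : PolicyFamily S ν d) (t : ℕ) (θ : 𝔼) : 𝔼 :=
  ∫ τ, M.R (τ t).1 (τ t).2 • truncScore π (t + 1) τ θ ∂(M.trajLaw π θ)

/-- The Hessian of the expected reward at time `t`. -/
noncomputable def stepHessian (π : PolicyFamily S ν d) (t : ℕ) (θ : 𝔼) : 𝔼 →L[ℝ] 𝔼 :=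
  ∫ τ, M.R (τ t).1 (τ t).2 • truncScoreDeriv π (t + 1) τ θ +
    (innerSL ℝ (truncScore π (t + 1) τ θ)).smulRight
      (M.R (τ t).1 (τ t).2 • truncScore π (t + 1) τ θ) ∂(M.trajLaw π θ)

lemma hasGradientAt_stepJ (hLS : π.LS G₁ G₂) (t : ℕ) (θ : 𝔼) :
    HasGradientAt (M.stepJ π t) (M.stepGradient π t θ) θ :=
  hasGradientAt_integral_trajLaw M hLS (t + 1) (M.stronglyMeasurable_reward t)
    (M.dependsOn_reward t) (fun _ => M.abs_R_le _ _) θ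

lemma hasFDerivAt_stepGradient (hLS : π.LS G₁ G₂) (t : ℕ) (θ : 𝔼) :
    HasFDerivAt (M.stepGradient π t) (M.stepHessian π t θ) θ := by
  have hR := M.Rmax_pos.le
  refine hasFDerivAt_integral_trajLaw M hLS (t + 1)
    (Z := fun θ τ => M.R (τ t).1 (τ t).2 • truncScore π (t + 1) τ θ)
    (Z' := fun θ τ => M.R (τ t).1 (τ t).2 • truncScoreDeriv π (t + 1) τ θ)
    (C := M.Rmax * ((t + 1 : ℕ) * G₁)) (C' := M.Rmax * ((t + 1 : ℕ) * G₂))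
    (fun θ => (M.stronglyMeasurable_reward t).smul (stronglyMeasurable_truncScore hLS _ θ))
    (fun θ x y h => ?_) (fun θ τ => ?_)
    (fun θ => (M.stronglyMeasurable_reward t).smul (stronglyMeasurable_truncScoreDeriv hLS _ θ))
    (fun θ τ => ?_) (fun θ τ => (hasFDerivAt_truncScore hLS _ τ θ).fun_const_smul _) θ
  · have h1 := M.dependsOn_reward t h
    have h2 := dependsOn_truncScore (π := π) (t + 1) θ h
    simp only at h1 h2 ⊢
    rw [h1, h2]
  · rw [norm_smul]
    exact mul_le_mul (M.abs_R_le _ _) (norm_truncScore_le hLS _ τ θ) (norm_nonneg _) hR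
  · rw [norm_smul]
    exact mul_le_mul (M.abs_R_le _ _) (norm_truncScoreDeriv_le hLS _ τ θ) (norm_nonneg _) hR

lemma norm_stepJ_le (t : ℕ) (θ : 𝔼) : ‖M.stepJ π t θ‖ ≤ M.Rmax := by
  simpa [stepJ] using norm_integral_le_of_norm_le_const (μ := M.trajLaw π θ)
    (f := fun τ => M.R (τ t).1 (τ t).2)
    (ae_of_all _ fun τ : ℕ → S × A => M.abs_R_le (τ t).1 (τ t).2)

/-- The bound `E‖X‖ ≤ (E‖X‖² + c²) / (2c)` for the score `X`. -/
lemma norm_stepGradient_le (hLS : π.LS G₁ G₂) (t : ℕ) (θ : 𝔼) {c : ℝ} (hc : 0 < c) :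
    ‖M.stepGradient π t θ‖ ≤ M.Rmax * G₁ ^ 2 / (2 * c) * (t + 1) + M.Rmax * c / 2 := by
  have hR := M.Rmax_pos
  have hi := M.integrable_norm_truncScore_sq hLS (t + 1) θ
  have h2 := integral_norm_truncScore_sq_le M hLS (t + 1) θ
  have h1 : ‖M.stepGradient π t θ‖ ≤ ∫ τ, M.Rmax / (2 * c) * ‖truncScore π (t + 1) τ θ‖ ^ 2 +
      M.Rmax * c / 2 ∂(M.trajLaw π θ) := by
    refine norm_integral_le_of_norm_le ((hi.const_mul _).add (integrable_const _))
      (ae_of_all _ fun τ => ?_)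
    rw [norm_smul]
    refine (mul_le_mul_of_nonneg_right (M.abs_R_le _ _) (norm_nonneg _)).trans ?_
    -- The gap in the inequality between `‖X‖` and `(‖X‖² + c²) / (2c)` is a complete square.
    have h3 : M.Rmax / (2 * c) * ‖truncScore π (t + 1) τ θ‖ ^ 2 + M.Rmax * c / 2 -
        M.Rmax * ‖truncScore π (t + 1) τ θ‖ =
        M.Rmax / (2 * c) * (‖truncScore π (t + 1) τ θ‖ - c) ^ 2 := by
      field_simp; ring
    have h4 : 0 ≤ M.Rmax / (2 * c) * (‖truncScore π (t + 1) τ θ‖ - c) ^ 2 := by positivity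
    linarith
  rw [integral_add (hi.const_mul _) (integrable_const _), integral_const_mul] at h1
  simp only [integral_const, probReal_univ, one_smul] at h1
  refine h1.trans (add_le_add_left
    ((mul_le_mul_of_nonneg_left h2 (by positivity : 0 ≤ M.Rmax / (2 * c))).trans_eq ?_) _)
  push_cast
  ring

/-- The score derivative contributes at most `(t + 1) G₂`. The rank-one part has norm at most `Rmax
‖X‖²`, whose mean is linear in `t` by the second-moment bound. -/
lemma norm_stepHessian_le (hLS : π.LS G₁ G₂) (t : ℕ) (θ : 𝔼) :
    ‖M.stepHessian π t θ‖ ≤ M.Rmax * (G₂ + G₁ ^ 2) * (t + 1) := by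
  have hR := M.Rmax_pos
  have hi := M.integrable_norm_truncScore_sq hLS (t + 1) θ
  have h2 := integral_norm_truncScore_sq_le M hLS (t + 1) θ
  have h1 : ‖M.stepHessian π t θ‖ ≤ ∫ τ, M.Rmax * ((t + 1 : ℕ) * G₂) +
      M.Rmax * ‖truncScore π (t + 1) τ θ‖ ^ 2 ∂(M.trajLaw π θ) := by
    refine norm_integral_le_of_norm_le ((integrable_const _).add (hi.const_mul _))
      (ae_of_all _ fun τ => (norm_add_le _ _).trans (add_le_add ?_ ?_))
    · rw [norm_smul]
      exact mul_le_mul (M.abs_R_le _ _) (norm_truncScoreDeriv_le hLS _ τ θ) (norm_nonneg _) hR.le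
    · rw [ContinuousLinearMap.norm_smulRight_apply, innerSL_apply_norm, norm_smul,
        mul_left_comm, ← sq]
      exact mul_le_mul_of_nonneg_right (M.abs_R_le _ _) (sq_nonneg _)
  rw [integral_add (integrable_const _) (hi.const_mul _), 
    integral_const_mul _ fun τ => ‖truncScore π (t + 1) τ θ‖ ^ 2] at h1
  simp only [integral_const, probReal_univ, one_smul] at h1
  refine h1.trans ((add_le_add_right (mul_le_mul_of_nonneg_left h2 hR.le) _).trans_eq ?_)
  push_cast
  ring

end Step

/-! ### Termwise differentiation of the discounted series -/

section Sum

variable (M : MDP S A)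

lemma integrable_discounted_reward (π : PolicyFamily S ν d) (t : ℕ) (θ : 𝔼) :
    Integrable (fun τ : ℕ → S × A => M.γ ^ t * M.R (τ t).1 (τ t).2) (M.trajLaw π θ) :=
  integrable_of_bound ((M.stronglyMeasurable_reward t).const_mul _)
    (M.norm_discounted_reward_le t)

lemma J_eq_tsum (π : PolicyFamily S ν d) (θ : 𝔼) :
    M.J π θ = ∑' t, M.γ ^ t * M.stepJ π t θ := by
  have h := hasSum_integral_of_summable_integral_norm (M.integrable_discounted_reward π · θ)
    (.of_nonneg_of_le (fun t => integral_nonneg fun τ => norm_nonneg _) (fun t => ?_)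
      ((summable_geometric_of_lt_one M.γ_pos.le M.γ_lt_one).mul_right M.Rmax))
  · rw [J, ← h.tsum_eq]
    exact tsum_congr fun t => integral_const_mul _ _
  · simpa using integral_mono (M.integrable_discounted_reward π t θ).norm
      (integrable_const (M.γ ^ t * M.Rmax)) (M.norm_discounted_reward_le t)

lemma truncJ_eq_sum (π : PolicyFamily S ν d) (H : ℕ) (θ : 𝔼) :
    M.truncJ π H θ = ∑ t ∈ range H, M.γ ^ t * M.stepJ π t θ := by
  rw [truncJ, integral_finsetSum _ fun t _ => M.integrable_discounted_reward π t θ]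
  exact sum_congr rfl fun t _ => integral_const_mul _ _

lemma norm_pow_smul_stepGradient_le (hLS : π.LS G₁ G₂) {c : ℝ} (hc : 0 < c) (t : ℕ) (θ : 𝔼) :
    ‖M.γ ^ t • M.stepGradient π t θ‖ ≤
      M.γ ^ t * (M.Rmax * G₁ ^ 2 / (2 * c) * (t + 1) + M.Rmax * c / 2) := by
  rw [norm_smul, Real.norm_of_nonneg (pow_nonneg M.γ_pos.le t)]
  exact mul_le_mul_of_nonneg_left (M.norm_stepGradient_le hLS t θ hc) (pow_nonneg M.γ_pos.le t)

lemma norm_pow_smul_stepHessian_le (hLS : π.LS G₁ G₂) (t : ℕ) (θ : 𝔼) :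
    ‖M.γ ^ t • M.stepHessian π t θ‖ ≤
      M.γ ^ t * (M.Rmax * (G₂ + G₁ ^ 2) * (t + 1) + 0) := by
  rw [norm_smul, Real.norm_of_nonneg (pow_nonneg M.γ_pos.le t), add_zero]
  exact mul_le_mul_of_nonneg_left (M.norm_stepHessian_le hLS t θ) (pow_nonneg M.γ_pos.le t)

lemma summable_pow_mul_add (a b : ℝ) :
    Summable fun n : ℕ => M.γ ^ n * (a * (n + 1) + b) := by
  simpa using (hasSum_geometric_mul_add M.γ_pos.le M.γ_lt_one 0 a b).summable

lemma hasFDerivAt_pow_mul_stepJ (hLS : π.LS G₁ G₂) (t : ℕ) (θ : 𝔼) :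
    HasFDerivAt (fun θ => M.γ ^ t * M.stepJ π t θ)
      (InnerProductSpace.toDual ℝ 𝔼 (M.γ ^ t • M.stepGradient π t θ)) θ := by
  simpa using (hasGradientAt_iff_hasFDerivAt.1 (M.hasGradientAt_stepJ hLS t θ)).const_mul (M.γ ^ t)

theorem hasGradientAt_J (hLS : π.LS G₁ G₂) (θ : 𝔼) :
    HasGradientAt (M.J π) (∑' t, M.γ ^ t • M.stepGradient π t θ) θ := by
  have hJ : M.J π = fun θ => ∑' t, M.γ ^ t * M.stepJ π t θ := funext (M.J_eq_tsum π)
  rw [hasGradientAt_iff_hasFDerivAt, hJ]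
  -- Only a summable bound uniform in `θ` is needed here, so `c = 1` suffices.
  have h := hasFDerivAt_tsum (M.summable_pow_mul_add _ _)
    (fun t θ => M.hasFDerivAt_pow_mul_stepJ hLS t θ)
    (fun t θ => by
      rw [LinearIsometryEquiv.norm_map]
      exact M.norm_pow_smul_stepGradient_le hLS one_pos t θ) (x₀ := θ)
    (.of_norm_bounded ((summable_geometric_of_lt_one M.γ_pos.le M.γ_lt_one).mul_right M.Rmax)
      fun t => ?_) θ
  · have hmap := (InnerProductSpace.toDual ℝ 𝔼).toContinuousLinearEquiv.map_tsum
      (f := fun t => M.γ ^ t • M.stepGradient π t θ) (L := .unconditional ℕ)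
    exact h.congr_fderiv hmap.symm
  · rw [norm_mul, Real.norm_of_nonneg (pow_nonneg M.γ_pos.le t)]
    exact mul_le_mul_of_nonneg_left (M.norm_stepJ_le t θ) (pow_nonneg M.γ_pos.le t)

theorem hasFDerivAt_gradient_J (hLS : π.LS G₁ G₂) (θ : 𝔼) :
    HasFDerivAt (gradient (M.J π)) (∑' t, M.γ ^ t • M.stepHessian π t θ) θ := by
  rw [funext fun θ => (M.hasGradientAt_J hLS θ).gradient]
  exact hasFDerivAt_tsum (M.summable_pow_mul_add _ _)
    (fun t θ => (M.hasFDerivAt_stepGradient hLS t θ).const_smul (M.γ ^ t))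
    (fun t θ => M.norm_pow_smul_stepHessian_le hLS t θ) (x₀ := θ)
    (.of_norm_bounded (M.summable_pow_mul_add _ _)
      fun t => M.norm_pow_smul_stepGradient_le hLS one_pos t θ) θ

theorem hasGradientAt_truncJ (hLS : π.LS G₁ G₂) (H : ℕ) (θ : 𝔼) :
    HasGradientAt (M.truncJ π H) (∑ t ∈ range H, M.γ ^ t • M.stepGradient π t θ) θ := by
  rw [hasGradientAt_iff_hasFDerivAt, funext (M.truncJ_eq_sum π H), map_sum]
  exact HasFDerivAt.fun_sum fun t _ => M.hasFDerivAt_pow_mul_stepJ hLS t θ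

theorem hasFDerivAt_gradient_truncJ (hLS : π.LS G₁ G₂) (H : ℕ) (θ : 𝔼) :
    HasFDerivAt (gradient (M.truncJ π H)) (∑ t ∈ range H, M.γ ^ t • M.stepHessian π t θ) θ := by
  rw [funext fun θ => (M.hasGradientAt_truncJ hLS H θ).gradient]
  exact HasFDerivAt.fun_sum fun t _ => (M.hasFDerivAt_stepGradient hLS t θ).const_smul (M.γ ^ t)

end Sum

/-! ### Policy gradient and policy Hessian formulas -/

section Formulas

variable (M : MDP S A)

/-- The policy gradient theorem for the truncated objective, in reward-to-go form. -/
theorem gradient_truncJ_eq (hLS : π.LS G₁ G₂) (H : ℕ) (θ : 𝔼) :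
    gradient (M.truncJ π H) θ = M.truncPolicyGradient π H θ := by
  have hint : ∀ (s : Finset ℕ) (h : ℕ), Integrable (fun τ : ℕ → S × A =>
      (∑ t ∈ s, M.γ ^ t * M.R (τ t).1 (τ t).2) • gradient (π.logDens (τ h).1 (τ h).2) θ)
      (M.trajLaw π θ) := fun s h => by
    refine integrable_of_bound (C := (∑ t ∈ s, M.γ ^ t * M.Rmax) * G₁)
      ((M.stronglyMeasurable_sum_reward s).smul
        ((hLS.stronglyMeasurable_gradient θ).comp_measurable (measurable_pi_apply h))) fun τ => ?_
    rw [norm_smul]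
    have := (norm_nonneg _).trans (M.norm_sum_reward_le s τ)
    exact mul_le_mul (M.norm_sum_reward_le s τ) (hLS.norm_gradient_le θ _ _) (norm_nonneg _) this
  have h := hasGradientAt_integral_trajLaw M hLS H (M.stronglyMeasurable_sum_reward (range H))
    (M.dependsOn_sum_reward fun t ht => mem_range.1 ht) (M.norm_sum_reward_le (range H)) θ
  refine h.gradient.trans ?_
  rw [truncPolicyGradient]
  simp_rw [truncScore, smul_sum, rewardToGo]
  rw [integral_finsetSum _ fun h _ => hint _ h,
    integral_finsetSum _ fun h _ => hint _ h]
  refine sum_congr rfl fun h hh => ?_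
  -- Rewards before time `h` are functions of the first `h` pairs, hence orthogonal to the score at
  -- time `h`; adding them completes the reward-to-go to the full return.
  have hpast := integral_smul_score_eq_zero M hLS h (M.stronglyMeasurable_sum_reward (range h))
    (M.dependsOn_sum_reward fun t ht => mem_range.1 ht) (M.norm_sum_reward_le (range h)) θ
  rw [← zero_add (∫ τ, (∑ t ∈ Ico h H, _) • _ ∂_), ← hpast, ← integral_add (hint _ h) (hint _ h)]
  refine integral_congr_ae (ae_of_all _ fun τ => ?_)
  beta_reduce
  rw [← add_smul, sum_range_add_sum_Ico _ (mem_range.1 hh).le]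

/-- The policy Hessian theorem for the truncated objective. -/
theorem hessian_truncJ_eq (hLS : π.LS G₁ G₂) (H : ℕ) (θ : 𝔼) :
    hessian (M.truncJ π H) θ = M.truncPolicyHessian π H θ := by
  have hgrad : ∀ θ τ, gradient (M.truncPhi π H τ) θ =
      ∑ h ∈ range H, M.rewardToGo H h τ • gradient (π.logDens (τ h).1 (τ h).2) θ :=
    fun θ τ => (M.hasGradientAt_truncPhi hLS H τ θ).gradient
  have hhess : ∀ θ τ, hessian (M.truncPhi π H τ) θ =
      ∑ h ∈ range H, M.rewardToGo H h τ • hessian (π.logDens (τ h).1 (τ h).2) θ :=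
    fun θ τ => (M.hasFDerivAt_gradient_truncPhi hLS H τ θ).fderiv
  have hJ : gradient (M.truncJ π H) =
      fun θ => ∫ τ, gradient (M.truncPhi π H τ) θ ∂(M.trajLaw π θ) := funext fun θ => by
    rw [M.gradient_truncJ_eq hLS, truncPolicyGradient]
    simp_rw [hgrad]
  have hnn : ∀ s : Finset ℕ, 0 ≤ ∑ t ∈ s, M.γ ^ t * M.Rmax := fun s =>
    sum_nonneg fun t _ => mul_nonneg (pow_nonneg M.γ_pos.le t) M.Rmax_pos.le
  -- The integrand `∇Φ` depends on `θ` too: its own derivative gives `∇²Φ`, and that of the law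
  -- gives the rank-one term.
  have key := hasFDerivAt_integral_trajLaw M hLS H
    (Z := fun θ τ => gradient (M.truncPhi π H τ) θ) (Z' := fun θ τ => hessian (M.truncPhi π H τ) θ)
    (C := ∑ h ∈ range H, (∑ t ∈ Ico h H, M.γ ^ t * M.Rmax) * G₁)
    (C' := ∑ h ∈ range H, (∑ t ∈ Ico h H, M.γ ^ t * M.Rmax) * G₂)
    (fun θ => ?_) (fun θ x y hxy => ?_) (fun θ τ => ?_) (fun θ => ?_) (fun θ τ => ?_)
    (fun θ τ => (M.hasFDerivAt_gradient_truncPhi hLS H τ θ).differentiableAt.hasFDerivAt) θ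
  · rw [hessian, hJ, key.fderiv, truncPolicyHessian]
    refine integral_congr_ae (ae_of_all _ fun τ => ?_)
    exact add_comm _ _
  · simp_rw [hgrad]
    exact Finset.stronglyMeasurable_fun_sum _ fun h _ => (M.stronglyMeasurable_sum_reward _).smul
      ((hLS.stronglyMeasurable_gradient θ).comp_measurable (measurable_pi_apply h))
  · simp only [hgrad]
    refine sum_congr rfl fun h hh => ?_
    have h1 : M.rewardToGo H h x = M.rewardToGo H h y :=
      M.dependsOn_sum_reward (fun t ht => (mem_Ico.1 ht).2) hxy
    rw [h1, hxy h (mem_range.1 hh)]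
  · rw [hgrad]
    refine norm_sum_le_of_le _ fun h _ => ?_
    rw [norm_smul]
    exact mul_le_mul (M.norm_sum_reward_le _ τ) (hLS.norm_gradient_le θ _ _) (norm_nonneg _) (hnn _)
  · simp_rw [hhess]
    exact Finset.stronglyMeasurable_fun_sum _ fun h _ => (M.stronglyMeasurable_sum_reward _).smul
      ((hLS.stronglyMeasurable_hessian θ).comp_measurable (measurable_pi_apply h))
  · rw [hhess]
    refine norm_sum_le_of_le _ fun h _ => ?_
    rw [norm_smul]
    exact mul_le_mul (M.norm_sum_reward_le _ τ) (hLS.norm_hessian_le θ _ _) (norm_nonneg _) (hnn _)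

end Formulas

/-! ### Truncation errors -/

section Truncation

variable (M : MDP S A)

theorem norm_gradient_J_sub_gradient_truncJ_le (hLS : π.LS G₁ G₂) (H : ℕ) (θ : 𝔼) :
    ‖gradient (M.J π) θ - gradient (M.truncJ π H) θ‖ ≤
      G₁ * M.Rmax / (1 - M.γ) * √(1 / (1 - M.γ) + (H : ℝ)) * M.γ ^ H := by
  have h1 : 0 < 1 - M.γ := sub_pos.2 M.γ_lt_one
  have hG := hLS.G₁_pos
  have hK : 0 < 1 / (1 - M.γ) + (H : ℝ) := by positivity
  -- With `K = 1 / (1 - γ) + H`, the tail bound is proportional to `G₁² K / (2c) + c / 2`. It is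
  -- minimized at `c = G₁ √K`, with value `G₁ √K`.
  have hc : 0 < G₁ * √(1 / (1 - M.γ) + (H : ℝ)) := mul_pos hG (Real.sqrt_pos.2 hK)
  rw [(M.hasGradientAt_J hLS θ).gradient, (M.hasGradientAt_truncJ hLS H θ).gradient]
  refine (summable_and_norm_tsum_sub_sum_le M.γ_pos.le M.γ_lt_one
    (M.norm_pow_smul_stepGradient_le hLS hc · θ) H).2.trans_eq ?_
  rw [add_comm (H : ℝ)]
  have hsq := Real.sq_sqrt hK.le
  generalize 1 / (1 - M.γ) + (H : ℝ) = K at *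
  have hs : √K ≠ 0 := (Real.sqrt_pos.2 hK).ne'
  nth_rw 2 [← hsq]
  field_simp
  ring

theorem norm_hessian_J_sub_hessian_truncJ_le (hLS : π.LS G₁ G₂) (H : ℕ) (θ : 𝔼) :
    ‖hessian (M.J π) θ - hessian (M.truncJ π H) θ‖ ≤
      M.Rmax * (G₂ + G₁ ^ 2) / (1 - M.γ) * ((H : ℝ) + 1 / (1 - M.γ)) * M.γ ^ H := by
  rw [hessian, hessian, (M.hasFDerivAt_gradient_J hLS θ).fderiv,
    (M.hasFDerivAt_gradient_truncJ hLS H θ).fderiv]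
  refine (summable_and_norm_tsum_sub_sum_le M.γ_pos.le M.γ_lt_one
    (M.norm_pow_smul_stepHessian_le hLS · θ) H).2.trans_eq ?_
  ring

end Truncation

end MDP

theorem lemma2 {S A : Type*} [MeasurableSpace S] [MeasurableSpace A]
    (M : MDP S A) (ν : Measure A) [SigmaFinite ν] (d : ℕ) (π : PolicyFamily S ν d)
    (G₁ G₂ : ℝ) (hLS : π.LS G₁ G₂) (H : ℕ) :
    -- the gradients and the Hessians exist everywhere
    (Differentiable ℝ (M.J π) ∧ Differentiable ℝ (gradient (M.J π))) ∧
    (Differentiable ℝ (M.truncJ π H) ∧ Differentiable ℝ (gradient (M.truncJ π H))) ∧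
    -- those of the truncated objective are the truncated policy gradient and policy Hessian
    (∀ θ, gradient (M.truncJ π H) θ = M.truncPolicyGradient π H θ ∧
      hessian (M.truncJ π H) θ = M.truncPolicyHessian π H θ) ∧
    -- the truncation errors
    (∀ θ, ‖gradient (M.J π) θ - gradient (M.truncJ π H) θ‖ ≤
        G₁ * M.Rmax / (1 - M.γ) * √(1 / (1 - M.γ) + (H : ℝ)) * M.γ ^ H ∧
      ‖hessian (M.J π) θ - hessian (M.truncJ π H) θ‖ ≤
        M.Rmax * (G₂ + G₁ ^ 2) / (1 - M.γ) * ((H : ℝ) + 1 / (1 - M.γ)) * M.γ ^ H) :=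
  ⟨⟨fun θ => (M.hasGradientAt_J hLS θ).differentiableAt,
      fun θ => (M.hasFDerivAt_gradient_J hLS θ).differentiableAt⟩,
    ⟨fun θ => (M.hasGradientAt_truncJ hLS H θ).differentiableAt,
      fun θ => (M.hasFDerivAt_gradient_truncJ hLS H θ).differentiableAt⟩,
    fun θ => ⟨M.gradient_truncJ_eq hLS H θ, M.hessian_truncJ_eq hLS H θ⟩,
    fun θ => ⟨M.norm_gradient_J_sub_gradient_truncJ_le hLS H θ,
      M.norm_hessian_J_sub_hessian_truncJ_le hLS H θ⟩⟩
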